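/- Fix a countably infinite set of variables. Linear terms are expressions $t = a_1x_1+\dots+a_dx_d+c$ with integer coefficients $a_i$ and integer constant $c$; $\|t\|$ denotes the largest absolute value of a coefficient or of the constant of $t$. Consider formulae over the integers built from linear inequalities $t<0$ and modulo constraints $t\equiv 0 \bmod q$ ($q\ge 1$) by $\lnot$, $\land$, the first-order quantifier $\exists y$, and the modulo counting quantifiers $\exists^{(x,q)}y$, where $x\neq y$ are variables and $q\ge 1$. The formula $\exists^{(x,q)}y\,\psi$ (in which $x$ is a free variable) holds under an assignment iff the number of values of $y$ that satisfy $\psi$ is finite and congruent modulo $q$ to the value of $x$. Two formulae are equivalent if they are satisfied by the same assignments of integers to the variables. For a formula $\varphi$ let - $|\varphi|$ be its length, i.e. the number of symbols needed to write it down, numbers being written in binary; - $\mathrm{lin}(\varphi)$ be the set of linear terms $t$ that appear in a linear inequality $t<0$ of $\varphi$, and $\mathrm{hom}(\varphi)$ the set of homogeneous terms obtained from them by setting their constants to $0$; - $\mathrm{mod}(\varphi)$ be the set consisting of $1$ and of all moduli $q$ that appear in modulo constraints of $\varphi$. For a finite set $T$ of terms put $\|T\|=\max_{t\in T}\|t\|$,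 and for a finite set $A$ of integers put $\|A\|=\max_{n\in A}|n|$ (the maximum over the empty set being $0$). **Lemma.** There is an absolute constant $C$ such that every formula $\varphi$ as above is equivalent to a quantifier-free formula $\Phi$ with - $|\mathrm{lin}(\Phi)|$, $\|\mathrm{lin}(\Phi)\|$, $\|\mathrm{hom}(\Phi)\|$ and $\|\mathrm{mod}(\Phi)\|$ all at most $2^{2^{2^{C|\varphi|^2}}}$; - $|\mathrm{hom}(\Phi)|\le 2^{2^{C|\varphi|^2}}$ and $|\mathrm{mod}(\Phi)|\le|\varphi|$. -/

import Mathlib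

noncomputable section

namespace PAC

/-- First-order variables: a countably infinite set. -/
abbrev Var := ℕ

/-- Linear terms `a₁ x₁ + ⋯ + a_d x_d + c` with integer coefficients and constant;
variables outside the support of `coeff` have coefficient `0`. -/
@[ext]
structure LinTerm where
  coeff : Var →₀ ℤ
  const : ℤ
  deriving DecidableEq

/-- Assignments of integers to the variables. -/
abbrev Assignment := Var → ℤ

namespace LinTerm

/-- The value of a linear term under an assignment. -/
def eval (ν : Assignment) (t : LinTerm) : ℤ :=
  (t.coeff.sum fun x a => a * ν x) + t.const

/-- The homogeneous term obtained by setting the constant to `0`. -/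
def homogenize (t : LinTerm) : LinTerm := ⟨t.coeff, 0⟩

/-- The maximum absolute value of a coefficient or of the constant of the term. -/
def norm (t : LinTerm) : ℕ :=
  max (t.coeff.support.sup fun x => (t.coeff x).natAbs) t.const.natAbs

end LinTerm

/-- Formulae of Presburger arithmetic with the first-order quantifier `∃ y` and the modulo
counting quantifier `∃^(x,q) y` (where `x` and `y` are different variables and `q ≥ 1`), over
linear inequalities `t < 0` and modulo constraints `t ≡ 0 mod q`. -/
inductive Formula where
  | lt (t : LinTerm) : Formula
  | modEq (t : LinTerm) (q : ℕ+) : Formula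
  | neg (φ : Formula) : Formula
  | and (φ ψ : Formula) : Formula
  | ex (y : Var) (φ : Formula) : Formula
  | exMod (x : Var) (q : ℕ+) (y : Var) (hxy : x ≠ y) (φ : Formula) : Formula

/-- The number of symbols of the binary numeral of a natural number (the numeral of `0` has one
symbol). -/
def natLength (n : ℕ) : ℕ := max 1 n.size

/-- The number of symbols of an integer in binary, including a minus sign where needed. -/
def intLength (n : ℤ) : ℕ := (if n < 0 then 1 else 0) + natLength n.natAbs

/-- The number of symbols of `a₁ x₁ + ⋯ + a_d x_d + c`: each summand `aᵢ xᵢ` contributes its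
coefficient, its variable and one `+`. -/
def LinTerm.length (t : LinTerm) : ℕ :=
  (∑ x ∈ t.coeff.support, (intLength (t.coeff x) + 2)) + intLength t.const

namespace Formula

/-- The satisfaction relation `ν ⊨ φ`. The formula `∃^(x,q) y φ` holds iff the set of values of
`y` that satisfy `φ` is finite and its cardinality is congruent to the value of `x` modulo `q`. -/
def Sat : Assignment → Formula → Prop
  | ν, lt t => t.eval ν < 0
  | ν, modEq t q => ((q : ℕ) : ℤ) ∣ t.eval ν
  | ν, neg φ => ¬ Sat ν φ
  | ν, and φ ψ => Sat ν φ ∧ Sat ν ψ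
  | ν, ex y φ => ∃ n : ℤ, Sat (Function.update ν y n) φ
  | ν, exMod x q y _ φ =>
      {n : ℤ | Sat (Function.update ν y n) φ}.Finite ∧
        ({n : ℤ | Sat (Function.update ν y n) φ}.ncard : ℤ) ≡ ν x [ZMOD ((q : ℕ) : ℤ)]

/-- Two formulae are equivalent if they are satisfied by the same assignments. -/
def Equivalent (φ ψ : Formula) : Prop := ∀ ν : Assignment, Sat ν φ ↔ Sat ν ψ

/-- The formula contains no quantifier, neither first-order nor counting. -/
def QuantifierFree : Formula → Prop
  | lt _ => True
  | modEq _ _ => True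
  | neg φ => QuantifierFree φ
  | and φ ψ => QuantifierFree φ ∧ QuantifierFree ψ
  | ex _ _ => False
  | exMod _ _ _ _ _ => False

/-- The length `|φ|`: the number of symbols needed to write down `φ`, with numbers in binary.
The expressions counted are `t < 0`, `t ≡ 0 mod q`, `¬ φ`, `(φ ∧ ψ)`, `∃ y φ` and
`∃ ^ ( x , q ) y φ`, where every variable is one symbol. -/
def length : Formula → ℕ
  | lt t => t.length + 2
  | modEq t q => t.length + 3 + natLength q
  | neg φ => length φ + 1
  | and φ ψ => length φ + length ψ + 3
  | ex _ φ => length φ + 2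
  | exMod _ q _ _ φ => length φ + natLength q + 7

/-- The set of linear terms `t` that appear in a linear inequality `t < 0` of the formula. -/
def lin : Formula → Finset LinTerm
  | lt t => {t}
  | modEq _ _ => ∅
  | neg φ => lin φ
  | and φ ψ => lin φ ∪ lin ψ
  | ex _ φ => lin φ
  | exMod _ _ _ _ φ => lin φ

/-- The set of homogeneous linear terms obtained from the terms in `lin φ` by setting their
constants to `0`. -/
def hom (φ : Formula) : Finset LinTerm := (lin φ).image LinTerm.homogenize

/-- The set of moduli that appear in a modulo constraint of the formula; by convention it always
contains `1`. -/
def moduli : Formula → Finset ℕ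
  | lt _ => {1}
  | modEq _ q => {1, (q : ℕ)}
  | neg φ => moduli φ
  | and φ ψ => moduli φ ∪ moduli ψ
  | ex _ φ => moduli φ
  | exMod _ _ _ _ φ => moduli φ

end Formula

/-- The maximal norm of a term of a finite set of terms (`0` for the empty set). -/
def termsNorm (T : Finset LinTerm) : ℕ := T.sup LinTerm.norm

/-- The maximum of a finite set of natural numbers (`0` for the empty set). -/
def natNorm (A : Finset ℕ) : ℕ := A.sup id

end PAC

end

/-! The argument is semantic. Two assignments are called similar (`Sim`) if they agree on every
inequality with coefficients at most `A` and constants at most `K`, and on residues modulo `Q`. If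
the truth of a formula is invariant under similarity, it is a Boolean combination of the finitely
many atoms so bounded, all with the single modulus `Q` (`exists_over_of_sim`). Counting these atoms
gives the bounds.

Invariance is proved by induction on the formula (`Formula.sat_iff_of_simLength`). For a quantifier
on `y`, every bounded inequality compares `y` with a threshold, a rounded quotient of a form in the
other variables. Under sufficiently similar assignments, corresponding thresholds are congruent, and
their gaps are equal or large in the same direction (`Sim.similarGaps`). Hence each value of `y` has
a counterpart of the same residue in the same gap (`SimilarGaps.exists_same_cut`), which preserves
existence and finiteness. Between consecutive thresholds the solution set is periodic, so its size
modulo `q` depends only on residues of the end points (`SameCuts.ncard_modEq`).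

One quantifier roughly squares `A` and brings in a factor `A!` for `Q`. This is absorbed by taking
`A` doubly exponential in the length, `Q = A!`, and `K` triply exponential. -/

namespace PAC

/-! ### Families of thresholds on the integers -/

section Cuts

variable {I : Type*} {b b' : I → ℤ} {Q : ℤ}

/-- Differences of members of the two families are equal, or at least `Q` apart in the same
direction. -/
def SimilarGaps (Q : ℤ) (b b' : I → ℤ) : Prop :=
  ∀ i j, b i - b j = b' i - b' j ∨ (Q ≤ b i - b j ∧ Q ≤ b' i - b' j) ∨
    (b i - b j ≤ -Q ∧ b' i - b' j ≤ -Q)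

lemma SimilarGaps.symm (h : SimilarGaps Q b b') : SimilarGaps Q b' b := fun i j => by
  rcases h i j with h | h | h
  · exact Or.inl h.symm
  · exact Or.inr (Or.inl h.symm)
  · exact Or.inr (Or.inr h.symm)

lemma SimilarGaps.le_iff (hQ : 0 < Q) (h : SimilarGaps Q b b') (i j : I) :
    b i ≤ b j ↔ b' i ≤ b' j := by
  rcases h i j with h | h | h <;> omega

lemma SimilarGaps.lt_iff (hQ : 0 < Q) (h : SimilarGaps Q b b') (i j : I) :
    b i < b j ↔ b' i < b' j := by
  rcases h i j with h | h | h <;> omega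

/-- Every integer has a counterpart with the same residue and the same position relative to the
second family. -/
lemma SimilarGaps.exists_same_cut [Nonempty I] (hQ : 0 < Q) (h : SimilarGaps Q b b')
    (hb : ∀ i, b i ≡ b' i [ZMOD Q]) (n : ℤ) :
    ∃ n', n ≡ n' [ZMOD Q] ∧ ∀ k, n < b k ↔ n' < b' k := by
  classical
  have hlow : (∃ i, b i ≤ n) → ∃ i, b i ≤ n ∧ ∀ k, b k ≤ n → b k ≤ b i := by
    rintro ⟨i, hi⟩
    obtain ⟨_, ⟨⟨k, rfl, hk⟩, hmax⟩⟩ := Int.exists_greatest_of_bdd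
      (P := fun z => ∃ k, b k = z ∧ z ≤ n) ⟨n, fun z ⟨_, _, hz⟩ => hz⟩ ⟨b i, i, rfl, hi⟩
    exact ⟨k, hk, fun l hl => hmax _ ⟨l, rfl, hl⟩⟩
  have hhigh : (∃ i, n < b i) → ∃ i, n < b i ∧ ∀ k, n < b k → b i ≤ b k := by
    rintro ⟨i, hi⟩
    obtain ⟨_, ⟨⟨k, rfl, hk⟩, hmin⟩⟩ := Int.exists_least_of_bdd
      (P := fun z => ∃ k, b k = z ∧ n < z) ⟨n, fun z ⟨_, _, hz⟩ => hz.le⟩ ⟨b i, i, rfl, hi⟩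
    exact ⟨k, hk, fun l hl => hmin _ ⟨l, rfl, hl⟩⟩
  have hshift : ∀ i, n ≡ n - b i + b' i [ZMOD Q] := fun i => by
    have := (Int.ModEq.refl (n - b i)).add (hb i)
    simpa using this
  by_cases hl : ∃ i, b i ≤ n
  · obtain ⟨i, hi, hmax⟩ := hlow hl
    by_cases hh : ∃ j, n < b j
    · obtain ⟨j, hj, hmin⟩ := hhigh hh
      have key : ∀ n', b' i ≤ n' → n' < b' j → ∀ k, n < b k ↔ n' < b' k := by
        intro n' h1 h2 k
        constructor
        · intro hk
          have := (h.le_iff hQ j k).1 (hmin k hk)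
          omega
        · intro hk
          by_contra hk'
          have := (h.le_iff hQ k i).1 (hmax k (not_lt.1 hk'))
          omega
      -- Equal gaps are matched by translation. Otherwise both gaps are at least `Q`, so the first
      -- `Q` integers from `b' i` contain every residue.
      by_cases heq : b j - b i = b' j - b' i
      · exact ⟨n - b i + b' i, hshift i, key _ (by omega) (by omega)⟩
      · have hm0 := Int.emod_nonneg (n - b i) hQ.ne'
        have hm1 := Int.emod_lt_of_pos (n - b i) hQ
        refine ⟨b' i + (n - b i) % Q, ?_, key _ (by omega) ?_⟩
        · have h1 := (hb i).add (Int.mod_modEq (n - b i) Q).symm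
          simpa using h1
        · rcases h j i with h | h | h <;> omega
    · refine ⟨n - b i + b' i, hshift i, fun k => ?_⟩
      have hk : b k ≤ n := by
        by_contra hk
        exact hh ⟨k, by omega⟩
      have := (h.le_iff hQ k i).1 (hmax k hk)
      omega
  · have hall : ∀ k, n < b k := fun k => by
      by_contra hk
      exact hl ⟨k, by omega⟩
    obtain ⟨j, hj, hmin⟩ := hhigh ⟨Classical.arbitrary I, hall _⟩
    refine ⟨n - b j + b' j, hshift j, fun k => ?_⟩
    have := (h.le_iff hQ j k).1 (hmin k (hall k))
    have := hall k
    omega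

end Cuts

/-! ### Counting in periodic sets -/

section Periodic

open Classical in
/-- The number of elements of `S` in `[x, y)`. -/
noncomputable def cnt (S : Set ℤ) (x y : ℤ) : ℤ := ((Finset.Ico x y).filter (· ∈ S)).card

lemma cnt_add (S : Set ℤ) {x y z : ℤ} (hxy : x ≤ y) (hyz : y ≤ z) :
    cnt S x y + cnt S y z = cnt S x z := by
  classical
  unfold cnt
  rw [← Finset.Ico_union_Ico_eq_Ico hxy hyz, Finset.filter_union, Finset.card_union_of_disjoint]
  · push_cast; rfl
  · exact Finset.disjoint_filter_filter (Finset.Ico_disjoint_Ico_consecutive x y z)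

lemma cnt_congr {S T : Set ℤ} {x y : ℤ} (h : ∀ n, x ≤ n → n < y → (n ∈ S ↔ n ∈ T)) :
    cnt S x y = cnt T x y := by
  classical
  unfold cnt
  congr 2
  apply Finset.filter_congr
  intro n hn
  rw [Finset.mem_Ico] at hn
  exact h n hn.1 hn.2

lemma cnt_self (S : Set ℤ) (x : ℤ) : cnt S x x = 0 := by
  simp [cnt]

lemma cnt_shift {R : Set ℤ} {M : ℤ} (hR : ∀ n, n + M ∈ R ↔ n ∈ R) (x y : ℤ) :
    cnt R (x + M) (y + M) = cnt R x y := by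
  classical
  unfold cnt
  congr 1
  symm
  apply Finset.card_bij (fun n _ => n + M)
  · intro n hn
    simp only [Finset.mem_filter, Finset.mem_Ico] at hn ⊢
    exact ⟨by omega, (hR n).2 hn.2⟩
  · intro n _ m _ h
    simpa using h
  · intro n hn
    simp only [Finset.mem_filter, Finset.mem_Ico] at hn
    refine ⟨n - M, ?_, by ring⟩
    simp only [Finset.mem_filter, Finset.mem_Ico]
    exact ⟨by omega, (hR _).1 (by simpa using hn.2)⟩

lemma mem_add_mul_iff {R : Set ℤ} {Q : ℤ} (hR : ∀ n m, n ≡ m [ZMOD Q] → (n ∈ R ↔ m ∈ R))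
    (k n : ℤ) : n + Q * k ∈ R ↔ n ∈ R :=
  hR _ _ (by simp [Int.ModEq])

lemma cnt_period_mul {R : Set ℤ} {Q : ℤ} (hQ : 0 < Q)
    (hR : ∀ n m, n ≡ m [ZMOD Q] → (n ∈ R ↔ m ∈ R)) (x : ℤ) (k : ℕ) :
    cnt R x (x + Q * k) = k * cnt R x (x + Q) := by
  induction k with
  | zero => simp [cnt_self]
  | succ k ih =>
    have h0 : 0 ≤ Q * (k : ℤ) := by positivity
    have h1 := cnt_add R (x := x) (y := x + Q * k) (z := x + Q * (k + 1)) (by omega) (by linarith)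
    have h2 := cnt_shift (mem_add_mul_iff hR k) x (x + Q)
    have h3 : x + Q + Q * (k : ℤ) = x + Q * (k + 1) := by ring
    rw [h3] at h2
    push_cast
    rw [← h1, ih, h2]
    ring

/-- In a set of period `Q`, the count in an interval modulo `q` depends only on the residues of
the end points modulo `Q * q`. -/
lemma cnt_modEq_of_periodic {R : Set ℤ} {Q q : ℤ} (hQ : 0 < Q) (hq : 0 < q)
    (hR : ∀ n m, n ≡ m [ZMOD Q] → (n ∈ R ↔ m ∈ R)) {x y x' y' : ℤ} (hxy : x ≤ y) (hxy' : x' ≤ y')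
    (hx : x ≡ x' [ZMOD (Q * q)]) (hy : y ≡ y' [ZMOD (Q * q)]) :
    cnt R x y ≡ cnt R x' y' [ZMOD q] := by
  -- Moving the right end by a multiple of `Q * q` adds a multiple of `q` full periods, all with the
  -- same count.
  have key : ∀ {x y z : ℤ}, x ≤ y → y ≤ z → y ≡ z [ZMOD (Q * q)] →
      cnt R x y ≡ cnt R x z [ZMOD q] := by
    intro x y z hxy hyz h
    obtain ⟨k, hk⟩ := h.dvd
    have hk0 : 0 ≤ k := by
      by_contra hneg
      have : Q * q * k < 0 := mul_neg_of_pos_of_neg (by positivity) (by omega)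
      omega
    lift k to ℕ using hk0
    lift q to ℕ using hq.le
    have hz : z = y + Q * ((q * k : ℕ) : ℤ) := by push_cast; linarith
    rw [← cnt_add R hxy hyz]
    have h2 := cnt_period_mul hQ hR y (q * k)
    rw [hz, h2]
    apply Int.modEq_of_dvd
    refine ⟨k * cnt R y (y + Q), ?_⟩
    push_cast
    ring
  obtain ⟨k, hk⟩ := hx.dvd
  have hx' : x' = x + Q * (q * k) := by linarith
  have hs : cnt R x' y' = cnt R x (y' - Q * (q * k)) := by
    have := cnt_shift (mem_add_mul_iff hR (q * k)) x (y' - Q * (q * k))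
    rw [← this, hx']
    congr 1
    ring
  have hy2 : y ≡ y' - Q * (q * k) [ZMOD (Q * q)] := by
    refine hy.trans (Int.modEq_of_dvd ⟨-k, by ring⟩)
  rw [hs]
  rcases le_total y (y' - Q * (q * k)) with h | h
  · exact key hxy h hy2
  · exact (key (by omega) h hy2.symm).symm

end Periodic

/-! ### Sets determined by residues and positions relative to thresholds -/

section Transfer

variable {I : Type*} {b b' : I → ℤ} {Q q : ℤ} {S S' : Set ℤ}

/-- Membership of an integer in `S` or `S'` depends only on its residue modulo `Q` and its
position relative to the respective thresholds, and does so in the same way. -/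
def SameCuts (Q : ℤ) (b b' : I → ℤ) (S S' : Set ℤ) : Prop :=
  ∀ n n', n ≡ n' [ZMOD Q] → (∀ k, n < b k ↔ n' < b' k) → (n ∈ S ↔ n' ∈ S')

lemma SameCuts.symm (h : SameCuts Q b b' S S') : SameCuts Q b' b S' S :=
  fun n n' hn hk => (h n' n hn.symm fun k => (hk k).symm).symm

/-- Two integers with the same residue and cut share a counterpart on the other side, and are both
compared with it. -/
lemma SameCuts.self [Nonempty I] (hQ : 0 < Q) (hg : SimilarGaps Q b b') (hb : ∀ i, b i ≡ b' i [ZMOD Q])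
    (h : SameCuts Q b b' S S') : SameCuts Q b b S S := by
  intro n m hnm hk
  obtain ⟨n', h1, h2⟩ := hg.exists_same_cut hQ hb n
  rw [h n n' h1 h2, h m n' (hnm.symm.trans h1) fun k => (hk k).symm.trans (h2 k)]

lemma SameCuts.nonempty [Nonempty I] (hQ : 0 < Q) (hg : SimilarGaps Q b b') (hb : ∀ i, b i ≡ b' i [ZMOD Q])
    (h : SameCuts Q b b' S S') (hS : S.Nonempty) : S'.Nonempty := by
  obtain ⟨n, hn⟩ := hS
  obtain ⟨n', h1, h2⟩ := hg.exists_same_cut hQ hb n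
  exact ⟨n', (h n n' h1 h2).1 hn⟩

/-- An element with no threshold on one side could be moved that way by all multiples of `Q` without
leaving `S`. -/
lemma SameCuts.cut_of_finite (hQ : 0 < Q) (h : SameCuts Q b b S S) (hS : S.Finite) {n : ℤ}
    (hn : n ∈ S) : (∃ i, b i ≤ n) ∧ ∃ i, n < b i := by
  constructor
  · by_contra hne
    push Not at hne
    refine Set.infinite_of_injective_forall_mem (f := fun k : ℕ => n - Q * k) ?_ ?_ hS
    · intro k l hkl
      have : Q * (k : ℤ) = Q * l := by simpa using hkl
      exact_mod_cast mul_left_cancel₀ hQ.ne' this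
    · intro k
      refine (h n _ ?_ fun i => ?_).1 hn
      · simp [Int.ModEq]
      · have := hne i
        have : 0 ≤ Q * (k : ℤ) := by positivity
        constructor <;> intro <;> omega
  · by_contra hne
    push Not at hne
    refine Set.infinite_of_injective_forall_mem (f := fun k : ℕ => n + Q * k) ?_ ?_ hS
    · intro k l hkl
      have : Q * (k : ℤ) = Q * l := by simpa using hkl
      exact_mod_cast mul_left_cancel₀ hQ.ne' this
    · intro k
      refine (h n _ ?_ fun i => ?_).1 hn
      · simp [Int.ModEq]
      · have := hne i
        have : 0 ≤ Q * (k : ℤ) := by positivity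
        constructor <;> intro <;> omega

lemma SameCuts.finite [Nonempty I] (hQ : 0 < Q) (hg : SimilarGaps Q b b') (hb : ∀ i, b i ≡ b' i [ZMOD Q])
    (hfin : (Set.range b').Finite) (h : SameCuts Q b b' S S') (hS : S.Finite) : S'.Finite := by
  obtain ⟨l, hl⟩ := hfin.bddBelow
  obtain ⟨u, hu⟩ := hfin.bddAbove
  refine (Set.finite_Ico l u).subset fun n' hn' => ?_
  obtain ⟨n, h1, h2⟩ := hg.symm.exists_same_cut hQ (fun i => (hb i).symm) n'
  have hn := (h.symm n' n h1 h2).1 hn'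
  obtain ⟨⟨i, hi⟩, ⟨j, hj⟩⟩ := (h.self hQ hg hb).cut_of_finite hQ hS hn
  have h3 := hl ⟨i, rfl⟩
  have h4 := hu ⟨j, rfl⟩
  have h5 := (h2 j).2 hj
  have h6 : b' i ≤ n' := by
    by_contra hc
    have := (h2 i).1 (not_le.1 hc)
    omega
  exact ⟨h3.trans h6, h5.trans_le h4⟩

/-- Counts between corresponding thresholds are congruent. -/
lemma SameCuts.cnt_modEq [Nonempty I] (hQ : 0 < Q) (hq : 0 < q) (hg : SimilarGaps Q b b')
    (hb : ∀ i, b i ≡ b' i [ZMOD (Q * q)]) (h : SameCuts Q b b' S S') {i₀ : I} (h₀ : ∀ i, b i₀ ≤ b i) (i : I) :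
    cnt S (b i₀) (b i) ≡ cnt S' (b' i₀) (b' i) [ZMOD q] := by
  have hbQ : ∀ i, b i ≡ b' i [ZMOD Q] := fun i => (hb i).of_mul_right q
  have hself := h.self hQ hg hbQ
  -- Induction on the distance from the least threshold, adding one gap between consecutive
  -- thresholds at a time.
  suffices H : ∀ (m : ℕ) (i : I), (b i - b i₀).toNat ≤ m →
      cnt S (b i₀) (b i) ≡ cnt S' (b' i₀) (b' i) [ZMOD q] from H _ i le_rfl
  intro m
  induction m with
  | zero =>
    intro i hi
    have h1 := h₀ i
    have h2 : b i = b i₀ := by omega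
    have h3 : b' i = b' i₀ :=
      le_antisymm ((hg.le_iff hQ _ _).1 h2.le) ((hg.le_iff hQ _ _).1 h2.ge)
    rw [h2, h3, cnt_self, cnt_self]
  | succ m ih =>
    intro i hi
    by_cases heq : b i = b i₀
    · exact ih i (by omega)
    have hlt : b i₀ < b i := lt_of_le_of_ne (h₀ i) (Ne.symm heq)
    obtain ⟨_, ⟨⟨j, rfl, hj⟩, hmax⟩⟩ := Int.exists_greatest_of_bdd
      (P := fun z => ∃ k, b k = z ∧ z < b i) ⟨b i, fun z ⟨_, _, hz⟩ => hz.le⟩ ⟨b i₀, i₀, rfl, hlt⟩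
    have hgap : ∀ k, b k < b i → b k ≤ b j := fun k hk => hmax _ ⟨k, rfl, hk⟩
    have h1 := ih j (by have := h₀ j; omega)
    have hj' := (hg.lt_iff hQ j i).1 hj
    have h₀' := (hg.le_iff hQ i₀ j).1 (h₀ j)
    rw [← cnt_add S (h₀ j) hj.le, ← cnt_add S' h₀' hj'.le]
    refine h1.add ?_
    have hcut : ∀ n, b j ≤ n → n < b i → ∀ k, n < b k ↔ b i ≤ b k := by
      intro n hn1 hn2 k
      constructor
      · intro hk
        by_contra hc
        have := hgap k (not_le.1 hc)
        omega
      · intro hk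
        omega
    have hcut' : ∀ n, b' j ≤ n → n < b' i → ∀ k, n < b' k ↔ b i ≤ b k := by
      intro n hn1 hn2 k
      constructor
      · intro hk
        by_contra hc
        have := (hg.le_iff hQ _ _).1 (hgap k (not_le.1 hc))
        omega
      · intro hk
        have := (hg.le_iff hQ _ _).1 hk
        omega
    -- The `Q`-periodic extension of the pattern of `S` in this gap. It also describes `S'` in the
    -- corresponding gap.
    let R : Set ℤ := {n | ∃ m, b j ≤ m ∧ m < b i ∧ m ∈ S ∧ m ≡ n [ZMOD Q]}
    have hR : ∀ n m, n ≡ m [ZMOD Q] → (n ∈ R ↔ m ∈ R) := by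
      intro n m hnm
      constructor
      · rintro ⟨l, h1, h2, h3, h4⟩
        exact ⟨l, h1, h2, h3, h4.trans hnm⟩
      · rintro ⟨l, h1, h2, h3, h4⟩
        exact ⟨l, h1, h2, h3, h4.trans hnm.symm⟩
    have hSR : cnt S (b j) (b i) = cnt R (b j) (b i) := by
      refine cnt_congr fun n hn1 hn2 => ⟨fun hn => ⟨n, hn1, hn2, hn, rfl⟩, ?_⟩
      rintro ⟨m, h1, h2, h3, h4⟩
      exact (hself m n h4 fun k => (hcut m h1 h2 k).trans (hcut n hn1 hn2 k).symm).1 h3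
    have hSR' : cnt S' (b' j) (b' i) = cnt R (b' j) (b' i) := by
      refine cnt_congr fun n hn1 hn2 => ⟨fun hn => ?_, ?_⟩
      · obtain ⟨m, h1, h2⟩ := hg.symm.exists_same_cut hQ (fun i => (hbQ i).symm) n
        refine ⟨m, ?_, (h2 i).1 hn2, (h.symm n m h1 h2).1 hn, h1.symm⟩
        by_contra hc
        have := (h2 j).2 (not_le.1 hc)
        omega
      · rintro ⟨m, h1, h2, h3, h4⟩
        exact (h m n h4 fun k => (hcut m h1 h2 k).trans (hcut' n hn1 hn2 k).symm).1 h3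
    rw [hSR, hSR']
    exact cnt_modEq_of_periodic hQ hq hR hj.le hj'.le (hb j) (hb i)

lemma ncard_eq_cnt {S : Set ℤ} {x y : ℤ} (h : ∀ n ∈ S, x ≤ n ∧ n < y) :
    (S.ncard : ℤ) = cnt S x y := by
  classical
  unfold cnt
  rw [← Set.ncard_coe_finset]
  congr 2
  ext n
  simp only [Finset.coe_filter, Finset.mem_Ico, Set.mem_ofPred_eq]
  exact ⟨fun hn => ⟨h n hn, hn⟩, fun hn => hn.2⟩

/-- Finite sets of this kind lie between the least and the greatest threshold, so their sizes are
counts between corresponding thresholds. -/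
lemma SameCuts.ncard_modEq [Nonempty I] (hQ : 0 < Q) (hq : 0 < q) (hg : SimilarGaps Q b b')
    (hb : ∀ i, b i ≡ b' i [ZMOD (Q * q)]) (hfin : (Set.range b).Finite)
    (hfin' : (Set.range b').Finite) (h : SameCuts Q b b' S S') (hS : S.Finite) :
    (S.ncard : ℤ) ≡ S'.ncard [ZMOD q] := by
  have hbQ : ∀ i, b i ≡ b' i [ZMOD Q] := fun i => (hb i).of_mul_right q
  obtain ⟨_, ⟨i₀, rfl⟩, h₀⟩ :=
    Set.exists_min_image (Set.range b) id hfin (Set.range_nonempty b)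
  obtain ⟨_, ⟨i₁, rfl⟩, h₁⟩ :=
    Set.exists_max_image (Set.range b) id hfin (Set.range_nonempty b)
  have h₀ : ∀ i, b i₀ ≤ b i := fun i => h₀ _ ⟨i, rfl⟩
  have h₁ : ∀ i, b i ≤ b i₁ := fun i => h₁ _ ⟨i, rfl⟩
  have hS' := h.finite hQ hg hbQ hfin' hS
  have hself := h.self hQ hg hbQ
  have hself' := h.symm.self hQ hg.symm fun i => (hbQ i).symm
  rw [ncard_eq_cnt (S := S) (x := b i₀) (y := b i₁), ncard_eq_cnt (S := S') (x := b' i₀)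
    (y := b' i₁)]
  · exact h.cnt_modEq hQ hq hg hb h₀ i₁
  · intro n hn
    obtain ⟨⟨i, hi⟩, ⟨j, hj⟩⟩ := hself'.cut_of_finite hQ hS' hn
    exact ⟨((hg.le_iff hQ _ _).1 (h₀ i)).trans hi, hj.trans_le ((hg.le_iff hQ _ _).1 (h₁ j))⟩
  · intro n hn
    obtain ⟨⟨i, hi⟩, ⟨j, hj⟩⟩ := hself.cut_of_finite hQ hS hn
    exact ⟨(h₀ i).trans hi, hj.trans_le (h₁ j)⟩

end Transfer

/-! ### Similar assignments -/

/-- The value of the homogeneous form with coefficients `f` in the variables of `X`. -/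
def form (X : Finset Var) (f : Var → ℤ) (ν : Assignment) : ℤ := ∑ x ∈ X, f x * ν x

/-- The assignments agree on all inequalities in the variables `X` with coefficients bounded by
`A` and constants bounded by `K`, and on all residues modulo `Q` of variables in `X`. -/
structure Sim (X : Finset Var) (A K Q : ℕ) (ν ν' : Assignment) : Prop where
  lt_iff : ∀ f : Var → ℤ, (∀ x, |f x| ≤ A) → ∀ c : ℤ, |c| ≤ K →
    (form X f ν + c < 0 ↔ form X f ν' + c < 0)
  modEq : ∀ x ∈ X, ν x ≡ ν' x [ZMOD Q]

section

variable {X Y : Finset Var} {A A' K K' Q Q' : ℕ} {ν ν' : Assignment}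

lemma Sim.symm (h : Sim X A K Q ν ν') : Sim X A K Q ν' ν :=
  ⟨fun f hf c hc => (h.lt_iff f hf c hc).symm, fun x hx => (h.modEq x hx).symm⟩

lemma form_indicator (hYX : Y ⊆ X) (f : Var → ℤ) (ν : Assignment) :
    form X (fun x => if x ∈ Y then f x else 0) ν = form Y f ν := by
  unfold form
  rw [← Finset.sum_subset hYX]
  · exact Finset.sum_congr rfl fun x hx => by simp [hx]
  · intro x _ hx
    simp [hx]

lemma Sim.mono (h : Sim X A K Q ν ν') (hX : Y ⊆ X) (hA : A' ≤ A) (hK : K' ≤ K) (hQ : Q' ∣ Q) :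
    Sim Y A' K' Q' ν ν' := by
  refine ⟨fun f hf c hc => ?_, fun x hx => ?_⟩
  · rw [← form_indicator hX, ← form_indicator hX]
    refine h.lt_iff _ (fun x => ?_) c (hc.trans (by exact_mod_cast hK))
    split_ifs
    · exact (hf x).trans (by exact_mod_cast hA)
    · simp
  · exact (h.modEq x (hX hx)).of_dvd (by exact_mod_cast hQ)

lemma form_neg (f : Var → ℤ) (ν : Assignment) : form X (fun x => -f x) ν = -form X f ν := by
  simp [form]

lemma form_comb (a a' : ℤ) (f f' : Var → ℤ) (ν : Assignment) :
    form X (fun x => a * f x - a' * f' x) ν = a * form X f ν - a' * form X f' ν := by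
  simp only [form, Finset.mul_sum, ← Finset.sum_sub_distrib]
  exact Finset.sum_congr rfl fun x _ => by ring

lemma form_modEq {Q : ℤ} (h : ∀ x ∈ X, ν x ≡ ν' x [ZMOD Q]) (f : Var → ℤ) :
    form X f ν ≡ form X f ν' [ZMOD Q] := by
  apply Int.modEq_of_dvd
  unfold form
  rw [← Finset.sum_sub_distrib]
  refine Finset.dvd_sum fun x hx => ?_
  rw [← mul_sub]
  exact (h x hx).dvd.mul_left _

lemma form_insert_update {y : Var} (hy : y ∉ Y) (f : Var → ℤ) (ν : Assignment) (n : ℤ) :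
    form (insert y Y) f (Function.update ν y n) = f y * n + form Y f ν := by
  unfold form
  rw [Finset.sum_insert hy, Function.update_self]
  congr 1
  refine Finset.sum_congr rfl fun x hx => ?_
  rw [Function.update_of_ne (ne_of_mem_of_not_mem hx hy)]

lemma abs_form_le {f : Var → ℤ} (hf : ∀ x, |f x| ≤ A) (ν : Assignment) :
    |form X f ν| ≤ ∑ x ∈ X, A * |ν x| := by
  refine (Finset.abs_sum_le_sum_abs _ _).trans (Finset.sum_le_sum fun x _ => ?_)
  rw [abs_mul]
  exact mul_le_mul_of_nonneg_right (hf x) (abs_nonneg _)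

/-- Values of bounded forms agree, or exceed the bound on constants in the same direction. -/
lemma Sim.form_eq_or (h : Sim X A K Q ν ν') {f : Var → ℤ} (hf : ∀ x, |f x| ≤ A) :
    form X f ν = form X f ν' ∨ ((K : ℤ) < form X f ν ∧ (K : ℤ) < form X f ν') ∨
      (form X f ν < -K ∧ form X f ν' < -K) := by
  have hn : ∀ x, |(fun x => -f x) x| ≤ A := fun x => by simpa using hf x
  have h1 := fun c hc => h.lt_iff f hf c hc
  have h2 := fun c hc => h.lt_iff _ hn c hc
  simp only [form_neg] at h2
  generalize form X f ν = u at *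
  generalize form X f ν' = v at *
  have a1 := h1 K (by simp)
  have a2 := h2 K (by simp)
  by_cases hu : |u| ≤ K
  · left
    -- The constants `-u` and `u` are within the bound, and testing both signs of the form pins `v`
    -- to `u`.
    have b1 := h1 (-u) (by simpa using hu)
    have b2 := h2 u (by simpa using hu)
    omega
  · right
    rw [not_le, lt_abs] at hu
    omega

/-- Indices of the threshold of an inequality with a positive coefficient at the eliminated
variable: this coefficient, the other coefficients, and the constant. -/
structure Threshold (A K : ℕ) where
  lead : ℤ
  coeff : Var → ℤ
  const : ℤ
  lead_pos : 0 < lead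
  lead_le : lead ≤ A
  coeff_le : ∀ x, |coeff x| ≤ A
  const_le : |const| ≤ K

/-- The threshold under an assignment. -/
def Threshold.val (Y : Finset Var) (ν : Assignment) (i : Threshold A K) : ℤ :=
  -((i.const + form Y i.coeff ν) / i.lead)

/-- The negated floor is a ceiling: the threshold is the least integer at which the inequality
fails. -/
lemma Threshold.lt_val_iff (i : Threshold A K) (n : ℤ) :
    n < i.val Y ν ↔ i.lead * n + form Y i.coeff ν + i.const < 0 := by
  unfold Threshold.val
  rw [lt_neg, Int.ediv_lt_iff_lt_mul i.lead_pos]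
  constructor <;> intro h <;> nlinarith

lemma Threshold.finite_range (Y : Finset Var) (ν : Assignment) :
    (Set.range (Threshold.val (A := A) (K := K) Y ν)).Finite := by
  refine (Set.finite_Icc (-(K + ∑ x ∈ Y, A * |ν x|)) (K + ∑ x ∈ Y, A * |ν x|)).subset ?_
  rintro _ ⟨i, rfl⟩
  rw [Set.mem_Icc, ← abs_le]
  unfold Threshold.val
  rw [abs_neg]
  calc |(i.const + form Y i.coeff ν) / i.lead| ≤ |i.const + form Y i.coeff ν| :=
        Int.abs_ediv_le_abs _ _
    _ ≤ |i.const| + |form Y i.coeff ν| := abs_add_le _ _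
    _ ≤ _ := add_le_add i.const_le (abs_form_le i.coeff_le ν)

lemma Threshold.exists_rem (Y : Finset Var) (ν : Assignment) (i : Threshold A K) :
    ∃ e, 0 ≤ e ∧ e < i.lead ∧ i.lead * i.val Y ν = e - i.const - form Y i.coeff ν := by
  refine ⟨(i.const + form Y i.coeff ν) % i.lead, Int.emod_nonneg _ i.lead_pos.ne',
    Int.emod_lt_of_pos _ i.lead_pos, ?_⟩
  have := Int.mul_ediv_add_emod (i.const + form Y i.coeff ν) i.lead
  unfold Threshold.val
  linarith

/-- Thresholds of similar assignments are congruent, and their difference is known. -/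
lemma Threshold.exists_shift (hY : ∀ x ∈ Y, ν x ≡ ν' x [ZMOD ((Q * A.factorial : ℕ) : ℤ)])
    (i : Threshold A K) :
    ∃ k, form Y i.coeff ν' - form Y i.coeff ν = i.lead * k ∧ i.val Y ν' = i.val Y ν - k ∧
      (Q : ℤ) ∣ k := by
  obtain ⟨m, hm⟩ := (form_modEq hY i.coeff).dvd
  -- The factorial makes the change of the form exactly divisible by the leading coefficient, so
  -- rounding does not interfere.
  have hl : i.lead ∣ (A.factorial : ℤ) := by
    obtain ⟨l, hl⟩ := Int.eq_ofNat_of_zero_le i.lead_pos.le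
    have h1 := i.lead_pos
    have h2 := i.lead_le
    rw [hl] at h1 h2 ⊢
    exact_mod_cast Nat.dvd_factorial (by exact_mod_cast h1) (by exact_mod_cast h2)
  obtain ⟨u, hu⟩ := hl
  have hk : form Y i.coeff ν' - form Y i.coeff ν = i.lead * (Q * (u * m)) := by
    rw [hm]
    push_cast
    rw [hu]
    ring
  refine ⟨Q * (u * m), hk, ?_, dvd_mul_right _ _⟩
  unfold Threshold.val
  have : i.const + form Y i.coeff ν' =
      i.const + form Y i.coeff ν + i.lead * (Q * (u * m)) := by linarith
  rw [this, Int.add_mul_ediv_left _ _ i.lead_pos.ne']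
  ring

/-- Clearing denominators, the gap times both leads is `g` up to rounding and constants. The bound
allots `A ^ 2 * Q` to the gap, `A ^ 2` to a remainder and `A * K` to each constant. -/
lemma Threshold.le_sub_of_lt {i j : Threshold A K} {g : ℤ}
    (hg : g = i.lead * form Y j.coeff ν - j.lead * form Y i.coeff ν)
    (h : ((A ^ 2 * (Q + 1) + 2 * A * K : ℕ) : ℤ) < g) : (Q : ℤ) ≤ i.val Y ν - j.val Y ν := by
  obtain ⟨e, he0, he1, he⟩ := i.exists_rem Y ν
  obtain ⟨d, hd0, hd1, hd⟩ := j.exists_rem Y ν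
  have hi := i.lead_pos
  have hj := j.lead_pos
  have hi' := i.lead_le
  have hj' := j.lead_le
  have hc := abs_le.1 i.const_le
  have hc' := abs_le.1 j.const_le
  by_contra hlt
  rw [not_le] at hlt
  set D := i.val Y ν - j.val Y ν with hD
  have key : i.lead * j.lead * D =
      g + j.lead * e - i.lead * d - j.lead * i.const + i.lead * j.const := by
    rw [hg, hD]
    linear_combination j.lead * he - i.lead * hd
  have h1 : i.lead * j.lead * D ≤ A ^ 2 * Q := by
    calc i.lead * j.lead * D ≤ i.lead * j.lead * Q := by gcongr
      _ ≤ A * A * Q := by gcongr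
      _ = _ := by ring
  have h2 : 0 ≤ j.lead * e := by positivity
  have h3 : i.lead * d ≤ A * A := mul_le_mul hi' (by omega) hd0 (by positivity)
  have h4 : j.lead * i.const ≤ A * K := by
    calc j.lead * i.const ≤ j.lead * K := by gcongr; exact hc.2
      _ ≤ A * K := by gcongr
  have h5 : -(A * K : ℤ) ≤ i.lead * j.const := by
    have : i.lead * -j.const ≤ A * K := by
      calc i.lead * -j.const ≤ i.lead * K := by gcongr; linarith [hc'.1]
        _ ≤ A * K := by gcongr
    linarith
  push_cast at h
  nlinarith

/-- Cross-multiplying two thresholds eliminates `y` and leaves a form with coefficients at most `2 *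
A ^ 2`, to which similarity applies. If its values agree, both thresholds shift by the same amount;
if they are large, so are both gaps. -/
lemma Sim.similarGaps {q : ℕ}
    (h : Sim Y (2 * A ^ 2) (A ^ 2 * (Q + 1) + 2 * A * K) (Q * q * A.factorial) ν ν') :
    SimilarGaps (Q : ℤ) (Threshold.val (A := A) (K := K) Y ν)
      (Threshold.val (A := A) (K := K) Y ν') := by
  intro i j
  have hf : ∀ x, |(fun x => i.lead * j.coeff x - j.lead * i.coeff x) x| ≤ (2 * A ^ 2 : ℕ) := by
    intro x
    have h1 : ∀ i j : Threshold A K, |i.lead * j.coeff x| ≤ A * A := fun i j => by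
      rw [abs_mul, abs_of_pos i.lead_pos]
      exact mul_le_mul i.lead_le (j.coeff_le x) (abs_nonneg _) (by positivity)
    calc |i.lead * j.coeff x - j.lead * i.coeff x|
        ≤ |i.lead * j.coeff x| + |j.lead * i.coeff x| := abs_sub _ _
      _ ≤ A * A + A * A := add_le_add (h1 i j) (h1 j i)
      _ = _ := by push_cast; ring
  have hsim := h.form_eq_or hf
  rw [form_comb, form_comb] at hsim
  rcases hsim with hsim | hsim | hsim
  · left
    obtain ⟨k, hk1, hk2, -⟩ := i.exists_shift h.modEq
    obtain ⟨l, hl1, hl2, -⟩ := j.exists_shift h.modEq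
    have : i.lead * j.lead * (k - l) = 0 := by
      linear_combination hsim + i.lead * hl1 - j.lead * hk1
    have hne : i.lead * j.lead ≠ 0 := (mul_pos i.lead_pos j.lead_pos).ne'
    have := (mul_eq_zero.1 this).resolve_left hne
    omega
  · exact Or.inr (Or.inl ⟨Threshold.le_sub_of_lt rfl hsim.1, Threshold.le_sub_of_lt rfl hsim.2⟩)
  · right; right
    have h1 := Threshold.le_sub_of_lt (i := j) (j := i) (Y := Y) (ν := ν) (Q := Q) rfl
      (by linarith [hsim.1])
    have h2 := Threshold.le_sub_of_lt (i := j) (j := i) (Y := Y) (ν := ν') (Q := Q) rfl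
      (by linarith [hsim.2])
    omega

lemma Sim.threshold_modEq (h : Sim Y A' K' (Q * A.factorial) ν ν') (i : Threshold A K) :
    i.val Y ν ≡ i.val Y ν' [ZMOD Q] := by
  obtain ⟨k, -, hk, hd⟩ := i.exists_shift h.modEq
  rw [hk]
  apply Int.modEq_of_dvd
  simpa using hd

/-- Extending similar assignments by values in the same position relative to all thresholds. -/
lemma Sim.update (h : Sim Y A K Q ν ν') {y : Var} (hy : y ∉ Y) {n n' : ℤ}
    (hn : n ≡ n' [ZMOD Q])
    (hcut : ∀ i : Threshold A (K + 1), n < i.val Y ν ↔ n' < i.val Y ν') :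
    Sim (insert y Y) A K Q (Function.update ν y n) (Function.update ν' y n') := by
  refine ⟨fun f hf c hc => ?_, fun x hx => ?_⟩
  · rw [form_insert_update hy, form_insert_update hy]
    rcases lt_trichotomy (f y) 0 with hneg | h0 | hpos
    · have hc1 := abs_le.1 hc
      have hA := abs_le.1 (hf y)
      have := hcut ⟨-f y, fun x => -f x, -c - 1, by omega, by omega,
        fun x => by simpa using hf x, abs_le.2 ⟨by push_cast; omega, by push_cast; omega⟩⟩
      simp only [Threshold.lt_val_iff, form_neg, neg_mul] at this
      omega
    · rw [h0]
      simpa using h.lt_iff f hf c hc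
    · have := hcut ⟨f y, f, c, hpos, (le_abs_self _).trans (hf y), hf, hc.trans (by simp)⟩
      simpa only [Threshold.lt_val_iff] using this
  · rcases Finset.mem_insert.1 hx with rfl | hx
    · simpa using hn
    · rw [Function.update_of_ne (ne_of_mem_of_not_mem hx hy),
        Function.update_of_ne (ne_of_mem_of_not_mem hx hy)]
      exact h.modEq x hx

instance : Nonempty (Threshold (A + 1) K) :=
  ⟨⟨1, fun _ => 0, 0, one_pos, by simp, fun _ => by simp; positivity, by simp⟩⟩

/-- The set of values of `y` that satisfy `P`. -/
def slice (P : Assignment → Prop) (y : Var) (ν : Assignment) : Set ℤ :=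
  {n | P (Function.update ν y n)}

/-- One variable can be eliminated at the price of larger bounds. -/
lemma Sim.slice {P : Assignment → Prop} {q : ℕ} {y : Var}
    (hP : ∀ ν ν', Sim (insert y Y) (A + 1) K Q ν ν' → (P ν ↔ P ν')) (hy : y ∉ Y) (hQ : 0 < Q)
    (hq : 0 < q)
    (h : Sim Y (2 * (A + 1) ^ 2) ((A + 1) ^ 2 * (Q + 1) + 2 * (A + 1) * (K + 1))
      (Q * q * (A + 1).factorial) ν ν') :
    ((slice P y ν).Nonempty → (slice P y ν').Nonempty) ∧
      ((slice P y ν).Finite → (slice P y ν').Finite ∧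
        ((slice P y ν).ncard : ℤ) ≡ (slice P y ν').ncard [ZMOD q]) := by
  have hg := h.similarGaps
  have hb : ∀ i : Threshold (A + 1) (K + 1), i.val Y ν ≡ i.val Y ν' [ZMOD (Q * q : ℤ)] := by
    simpa using h.threshold_modEq
  have hbQ : ∀ i : Threshold (A + 1) (K + 1), i.val Y ν ≡ i.val Y ν' [ZMOD (Q : ℤ)] :=
    fun i => (hb i).of_mul_right _
  have hQ' : (0 : ℤ) < Q := by exact_mod_cast hQ
  have hq' : (0 : ℤ) < q := by exact_mod_cast hq
  have hsim : Sim Y (A + 1) K Q ν ν' := by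
    refine h.mono subset_rfl (by nlinarith) (by nlinarith [Nat.zero_le (A * K), Nat.zero_le ((A + 1) ^ 2 * (Q + 1))]) ?_
    exact Dvd.intro _ (mul_assoc Q q _).symm
  have hS : SameCuts (Q : ℤ) (Threshold.val (A := A + 1) (K := K + 1) Y ν)
      (Threshold.val (A := A + 1) (K := K + 1) Y ν') (PAC.slice P y ν) (PAC.slice P y ν') :=
    fun n n' hn hcut => hP _ _ (hsim.update hy hn hcut)
  have f1 := Threshold.finite_range (A := A + 1) (K := K + 1) Y ν
  have f2 := Threshold.finite_range (A := A + 1) (K := K + 1) Y ν'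
  exact ⟨hS.nonempty hQ' hg hbQ, fun hf => ⟨hS.finite hQ' hg hbQ f2 hf,
    hS.ncard_modEq hQ' hq' hg hb f1 f2 hf⟩⟩

end

/-! ### Bounds in terms of the length of a formula -/

/-- Bound on coefficients. -/
def coeffBound (l : ℕ) : ℕ := 2 ^ 2 ^ l

/-- Bound on constants. -/
def constBound (l : ℕ) : ℕ := 2 ^ 2 ^ 2 ^ (l + 1)

/-- A common multiple of all moduli. -/
def modulus (l : ℕ) : ℕ := (coeffBound l).factorial

lemma tower_mono {a b : ℕ} (h : a ≤ b) : 2 ^ 2 ^ 2 ^ a ≤ 2 ^ 2 ^ 2 ^ b :=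
  Nat.pow_le_pow_right two_pos (Nat.pow_le_pow_right two_pos (Nat.pow_le_pow_right two_pos h))

lemma coeffBound_mono {l m : ℕ} (h : l ≤ m) : coeffBound l ≤ coeffBound m :=
  Nat.pow_le_pow_right two_pos (Nat.pow_le_pow_right two_pos h)

lemma constBound_mono {l m : ℕ} (h : l ≤ m) : constBound l ≤ constBound m :=
  tower_mono (Nat.add_le_add_right h 1)

lemma modulus_dvd {l m : ℕ} (h : l ≤ m) : modulus l ∣ modulus m :=
  Nat.factorial_dvd_factorial (coeffBound_mono h)

lemma two_le_coeffBound (l : ℕ) : 2 ≤ coeffBound l :=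
  Nat.le_self_pow (by positivity) 2

lemma two_pow_le_coeffBound (l : ℕ) : 2 ^ l ≤ coeffBound l :=
  Nat.pow_le_pow_right two_pos Nat.lt_two_pow_self.le

lemma sixteen_le_constBound (l : ℕ) : 16 ≤ constBound l :=
  tower_mono (show 1 ≤ l + 1 by omega)

/-- With `A = 2 ^ 2 ^ l`, `A! ≤ A ^ A = 2 ^ 2 ^ (l + 2 ^ l)`, and `l + 2 ^ l ≤ 2 ^ (l + 1)`. This
accounts for the `l + 1` in `constBound`. -/
lemma modulus_le_constBound (l : ℕ) : modulus l ≤ constBound l := by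
  refine (Nat.factorial_le_pow _).trans ?_
  unfold coeffBound constBound
  rw [← pow_mul, ← pow_add]
  refine Nat.pow_le_pow_right two_pos (Nat.pow_le_pow_right two_pos ?_)
  have := @Nat.lt_two_pow_self l
  rw [pow_succ]
  omega

lemma coeffBound_le_constBound (l : ℕ) : coeffBound l ≤ constBound l :=
  (Nat.self_le_factorial _).trans (modulus_le_constBound l)

lemma tower_pow_four (l : ℕ) : (2 ^ 2 ^ 2 ^ l) ^ 4 ≤ 2 ^ 2 ^ 2 ^ (l + 2) := by
  rw [← pow_mul, show 4 = 2 ^ 2 from rfl, ← pow_add]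
  refine Nat.pow_le_pow_right two_pos (Nat.pow_le_pow_right two_pos ?_)
  have := Nat.one_le_two_pow (n := l)
  rw [pow_add]
  omega

lemma coeffBound_pow_four (l : ℕ) : coeffBound l ^ 4 = coeffBound (l + 2) := by
  unfold coeffBound
  rw [← pow_mul, pow_add]
  rfl

/-- Increasing the length by 2 raises the bound to its fourth power, leaving room for the factor 2.
-/
lemma coeffBound_step (l : ℕ) : 2 * coeffBound l ^ 2 ≤ coeffBound (l + 2) := by
  rw [← coeffBound_pow_four]
  have := two_le_coeffBound l
  nlinarith [Nat.mul_le_mul this this, Nat.zero_le (coeffBound l ^ 2)]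

lemma constBound_step (l : ℕ) : coeffBound l ^ 2 * (modulus l + 1) +
    2 * coeffBound l * (constBound l + 1) ≤ constBound (l + 2) := by
  refine le_trans ?_ (tower_pow_four (l + 1))
  change _ ≤ constBound l ^ 4
  have h1 := coeffBound_le_constBound l
  have h2 := modulus_le_constBound l
  have h3 := sixteen_le_constBound l
  generalize constBound l = K at *
  calc _ ≤ K ^ 2 * (K + 1) + 2 * K * (K + 1) := by gcongr
    _ ≤ K ^ 2 * (2 * K) + 2 * K * (2 * K) := by gcongr <;> omega
    _ ≤ K ^ 2 * (K * K) := by nlinarith [Nat.zero_le (K ^ 2), Nat.zero_le (K ^ 3)]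
    _ = K ^ 4 := by ring

/-- A product of factorials divides the factorial of the sum, here of `2 * coeffBound l + q`. The
binary length `m` of `q` pays for its size. -/
lemma modulus_step (l m q : ℕ) (hq : 0 < q) (hqm : q ≤ 2 ^ m) :
    modulus l * q * (coeffBound l).factorial ∣ modulus (l + m + 2) := by
  have h1 : modulus l * q * (coeffBound l).factorial ∣
      (coeffBound l + q + coeffBound l).factorial := by
    refine dvd_trans ?_ (Nat.factorial_mul_factorial_dvd_factorial_add _ _)
    refine mul_dvd_mul ?_ dvd_rfl
    refine dvd_trans ?_ (Nat.factorial_mul_factorial_dvd_factorial_add _ _)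
    exact mul_dvd_mul dvd_rfl (Nat.dvd_factorial hq le_rfl)
  refine h1.trans (Nat.factorial_dvd_factorial ?_)
  rw [← coeffBound_pow_four]
  have h2 : coeffBound l ≤ coeffBound (l + m) := coeffBound_mono (by omega)
  have h3 : q ≤ coeffBound (l + m) :=
    hqm.trans ((two_pow_le_coeffBound m).trans (coeffBound_mono (by omega)))
  have h4 := two_le_coeffBound (l + m)
  generalize coeffBound (l + m) = B at *
  have h5 : 2 ^ 3 ≤ B ^ 3 := Nat.pow_le_pow_left h4 3
  calc _ ≤ B + B + B := by omega
    _ ≤ B ^ 3 * B := by nlinarith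
    _ = B ^ 4 := by ring

/-- Similarity with the bounds attached to a length. -/
def SimLength (X : Finset Var) (l : ℕ) (ν ν' : Assignment) : Prop :=
  Sim X (coeffBound l) (constBound l) (modulus l) ν ν'

section

variable {X Y : Finset Var} {l m : ℕ} {ν ν' : Assignment}

lemma SimLength.symm (h : SimLength X l ν ν') : SimLength X l ν' ν := Sim.symm h

lemma SimLength.mono (h : SimLength X l ν ν') (hX : Y ⊆ X) (hl : m ≤ l) : SimLength Y m ν ν' :=
  Sim.mono h hX (coeffBound_mono hl) (constBound_mono hl) (modulus_dvd hl)

lemma SimLength.slice {P : Assignment → Prop} {q : ℕ} {y : Var}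
    (hP : ∀ ν ν', SimLength X l ν ν' → (P ν ↔ P ν')) (hq : 0 < q) (hqm : q ≤ 2 ^ m)
    (h : SimLength (X.erase y) (l + m + 2) ν ν') :
    ((slice P y ν).Nonempty → (slice P y ν').Nonempty) ∧
      ((slice P y ν).Finite → (slice P y ν').Finite ∧
        ((slice P y ν).ncard : ℤ) ≡ (slice P y ν').ncard [ZMOD q]) := by
  obtain ⟨A, hA⟩ : ∃ A, coeffBound l = A + 1 :=
    ⟨_, (Nat.succ_pred_eq_of_pos (by have := two_le_coeffBound l; omega)).symm⟩
  refine Sim.slice (A := A) (K := constBound l) (Q := modulus l) (Y := X.erase y) ?_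
    (Finset.notMem_erase y X) (Nat.factorial_pos _) hq (Sim.mono h subset_rfl ?_ ?_ ?_)
  · intro μ μ' hμ
    rw [← hA] at hμ
    exact hP μ μ' (Sim.mono hμ (Finset.insert_erase_subset y X) le_rfl le_rfl dvd_rfl)
  · rw [← hA]
    exact (coeffBound_step l).trans (coeffBound_mono (by omega))
  · rw [← hA]
    exact (constBound_step l).trans (constBound_mono (by omega))
  · rw [← hA]
    exact modulus_step l m q hq hqm

end

/-! ### Formulae are invariant under similarity -/

lemma le_two_pow_natLength (n : ℕ) : n ≤ 2 ^ natLength n :=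
  (Nat.lt_size_self n).le.trans (Nat.pow_le_pow_right two_pos (le_max_right _ _))

lemma natAbs_le_two_pow_intLength (n : ℤ) : n.natAbs ≤ 2 ^ intLength n :=
  (le_two_pow_natLength _).trans (Nat.pow_le_pow_right two_pos (Nat.le_add_left _ _))

namespace LinTerm

lemma intLength_coeff_le (t : LinTerm) {x : Var} (hx : x ∈ t.coeff.support) :
    intLength (t.coeff x) ≤ t.length := by
  have := Finset.single_le_sum (f := fun x => intLength (t.coeff x) + 2)
    (fun _ _ => Nat.zero_le _) hx
  unfold length
  omega

lemma abs_coeff_le (t : LinTerm) (x : Var) : |t.coeff x| ≤ (2 ^ t.length : ℕ) := by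
  by_cases hx : x ∈ t.coeff.support
  · rw [Int.abs_eq_natAbs]
    exact_mod_cast (natAbs_le_two_pow_intLength _).trans
      (Nat.pow_le_pow_right two_pos (t.intLength_coeff_le hx))
  · rw [Finsupp.notMem_support_iff.1 hx]
    simp

lemma abs_const_le (t : LinTerm) : |t.const| ≤ (2 ^ t.length : ℕ) := by
  rw [Int.abs_eq_natAbs]
  exact_mod_cast (natAbs_le_two_pow_intLength _).trans
    (Nat.pow_le_pow_right two_pos (Nat.le_add_left _ _))

lemma card_support_le (t : LinTerm) : t.coeff.support.card ≤ t.length := by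
  have := Finset.card_nsmul_le_sum t.coeff.support (fun x => intLength (t.coeff x) + 2) 1
    (fun _ _ => by omega)
  unfold length
  simp only [smul_eq_mul, mul_one] at this
  omega

lemma eval_eq_form (t : LinTerm) (ν : Assignment) :
    t.eval ν = form t.coeff.support t.coeff ν + t.const := rfl

lemma eval_eq_form_of_subset (t : LinTerm) {X : Finset Var} (h : t.coeff.support ⊆ X)
    (ν : Assignment) : t.eval ν = form X t.coeff ν + t.const := by
  rw [eval_eq_form]
  congr 1
  refine Finset.sum_subset h fun x _ hx => ?_
  rw [Finsupp.notMem_support_iff.1 hx, zero_mul]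

end LinTerm

namespace Formula

/-- A set of variables that contains the free variables of the formula. -/
def vars : Formula → Finset Var
  | lt t => t.coeff.support
  | modEq t _ => t.coeff.support
  | neg φ => vars φ
  | and φ ψ => vars φ ∪ vars ψ
  | ex y φ => (vars φ).erase y
  | exMod x _ y _ φ => insert x ((vars φ).erase y)

lemma card_vars_le (φ : Formula) : φ.vars.card ≤ φ.length := by
  induction φ with
  | lt t => exact t.card_support_le.trans (Nat.le_add_right _ _)
  | modEq t q => exact t.card_support_le.trans (by simp only [length]; omega)
  | neg φ ih => exact ih.trans (Nat.le_add_right _ _)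
  | and φ ψ ih₁ ih₂ =>
    have := Finset.card_union_le φ.vars ψ.vars
    simp only [vars, length]
    omega
  | ex y φ ih => exact (Finset.card_erase_le.trans ih).trans (Nat.le_add_right _ _)
  | exMod x q y _ φ ih =>
    have h1 := Finset.card_insert_le x (φ.vars.erase y)
    have h2 := (Finset.card_erase_le (s := φ.vars) (a := y)).trans ih
    simp only [vars, length]
    omega

lemma three_le_length (φ : Formula) : 3 ≤ φ.length := by
  have hn : ∀ n, 1 ≤ natLength n := fun n => le_max_left _ _
  have ht : ∀ t : LinTerm, 1 ≤ t.length := fun t => by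
    have := hn t.const.natAbs
    unfold LinTerm.length intLength
    omega
  induction φ with
  | lt t => have := ht t; simp only [length]; omega
  | modEq t q => have := ht t; simp only [length]; omega
  | _ => simp only [length]; omega

/-- Each constructor adds enough length to pay for its elimination step: 2 for `∃`, and at least
`natLength q + 2` for a counting quantifier. -/
lemma sat_iff_of_simLength (φ : Formula) :
    ∀ ν ν', SimLength φ.vars φ.length ν ν' → (Sat ν φ ↔ Sat ν' φ) := by
  induction φ with
  | lt t =>
    intro ν ν' h
    have hl : 2 ^ t.length ≤ coeffBound (lt t).length :=
      (two_pow_le_coeffBound _).trans (coeffBound_mono (Nat.le_add_right _ _))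
    exact h.lt_iff t.coeff (fun x => (t.abs_coeff_le x).trans (by exact_mod_cast hl)) t.const
      (t.abs_const_le.trans (by exact_mod_cast hl.trans (coeffBound_le_constBound _)))
  | modEq t q =>
    intro ν ν' h
    have hq : (q : ℕ) ≤ coeffBound (modEq t q).length :=
      (le_two_pow_natLength _).trans ((two_pow_le_coeffBound _).trans
        (coeffBound_mono (Nat.le_add_left _ _)))
    have hq' : ((q : ℕ) : ℤ) ∣ modulus (modEq t q).length := by
      exact_mod_cast Nat.dvd_factorial q.pos hq
    have h1 := form_modEq h.modEq t.coeff
    have h2 := (h1.of_dvd hq').add_right t.const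
    exact h2.dvd_iff
  | neg φ ih =>
    intro ν ν' h
    exact not_congr (ih ν ν' (h.mono subset_rfl (Nat.le_add_right _ _)))
  | and φ ψ ih₁ ih₂ =>
    intro ν ν' h
    exact and_congr
      (ih₁ ν ν' (h.mono Finset.subset_union_left (by simp only [length]; omega)))
      (ih₂ ν ν' (h.mono Finset.subset_union_right (by simp only [length]; omega)))
  | ex y φ ih =>
    intro ν ν' h
    exact ⟨(h.slice (m := 0) ih one_pos le_rfl).1, (h.symm.slice (m := 0) ih one_pos le_rfl).1⟩
  | exMod x q y hxy φ ih =>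
    have key : ∀ ν ν', SimLength (exMod x q y hxy φ).vars (exMod x q y hxy φ).length ν ν' →
        Sat ν (exMod x q y hxy φ) → Sat ν' (exMod x q y hxy φ) := by
      rintro ν ν' h ⟨hf, hc⟩
      have h' := h.mono (m := φ.length + natLength q + 2) (Finset.subset_insert x _)
        (by simp only [length]; omega)
      obtain ⟨h1, h2⟩ := (h'.slice ih q.pos (le_two_pow_natLength q)).2 hf
      -- The values of `x` itself must agree modulo `q`, which divides the common modulus.
      refine ⟨h1, h2.symm.trans (hc.trans ((h.modEq x (Finset.mem_insert_self x _)).of_dvd ?_))⟩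
      have : (q : ℕ) ∣ modulus (exMod x q y hxy φ).length :=
        Nat.dvd_factorial q.pos ((le_two_pow_natLength q).trans ((two_pow_le_coeffBound _).trans
          (coeffBound_mono (by simp only [length]; omega))))
      exact_mod_cast this
    exact fun ν ν' h => ⟨key ν ν' h, key ν' ν h.symm⟩

/-! ### Boolean combinations of atoms -/

/-- Quantifier-free formulae with inequalities and moduli from given sets. -/
def Over (T : Finset LinTerm) (M : Finset ℕ) (Φ : Formula) : Prop :=
  Φ.QuantifierFree ∧ Φ.lin ⊆ T ∧ Φ.moduli ⊆ M

section

variable {T : Finset LinTerm} {M : Finset ℕ} {φ ψ : Formula}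

lemma Over.neg (h : Over T M φ) : Over T M (neg φ) := h

lemma Over.and (h : Over T M φ) (h' : Over T M ψ) : Over T M (and φ ψ) :=
  ⟨⟨h.1, h'.1⟩, Finset.union_subset h.2.1 h'.2.1, Finset.union_subset h.2.2 h'.2.2⟩

/-- A property determined by the truth values of finitely many formulae is expressed by a Boolean
combination of them. -/
lemma exists_over (hM : 1 ∈ M) (L : List Formula) (hL : ∀ α ∈ L, Over T M α) :
    ∀ P : Assignment → Prop,
      (∀ ν ν', (∀ α ∈ L, Sat ν α ↔ Sat ν' α) → (P ν ↔ P ν')) →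
      ∃ Φ, Over T M Φ ∧ ∀ ν, P ν ↔ Sat ν Φ := by
  induction L with
  | nil =>
    intro P hP
    -- The constant true is written `0 ≡ 0 mod 1`, which is where `1 ∈ M` enters.
    have hT : Over T M (Formula.modEq ⟨0, 0⟩ 1) :=
      ⟨trivial, Finset.empty_subset _, by simpa [moduli] using hM⟩
    have hs : ∀ ν, Sat ν (Formula.modEq ⟨0, 0⟩ 1) := fun ν => by simp [Sat]
    by_cases h : P 0
    · exact ⟨_, hT, fun ν => iff_of_true ((hP 0 ν (by simp)).1 h) (hs ν)⟩
    · exact ⟨_, hT.neg, fun ν => iff_of_false (fun hν => h ((hP 0 ν (by simp)).2 hν))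
        (not_not.2 (hs ν))⟩
  | cons α L ih =>
    intro P hP
    have hα := hL α List.mem_cons_self
    have key : ∀ p : Prop, ∃ Φ, Over T M Φ ∧ ∀ ν, (Sat ν α ↔ p) → (P ν ↔ Sat ν Φ) := by
      intro p
      obtain ⟨Φ, h1, h2⟩ := ih (fun β hβ => hL β (List.mem_cons_of_mem _ hβ))
        -- With the truth value of `α` fixed to `p`, this property depends only on `L` and agrees
        -- with `P`.
        (fun ν => ∃ μ, (∀ β ∈ L, Sat ν β ↔ Sat μ β) ∧ (Sat μ α ↔ p) ∧ P μ)
        (fun ν ν' h => exists_congr fun μ => and_congr_left fun _ =>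
          forall₂_congr fun β hβ => by rw [h β hβ])
      refine ⟨Φ, h1, fun ν hν => ?_⟩
      rw [← h2]
      constructor
      · exact fun h => ⟨ν, fun _ _ => Iff.rfl, hν, h⟩
      · rintro ⟨μ, h3, h4, h5⟩
        refine (hP ν μ fun β hβ => ?_).2 h5
        rcases List.mem_cons.1 hβ with rfl | hβ
        · exact hν.trans h4.symm
        · exact h3 β hβ
    obtain ⟨Φ₁, h1, h1'⟩ := key True
    obtain ⟨Φ₀, h0, h0'⟩ := key False
    refine ⟨Formula.neg (Formula.and (Formula.neg (Formula.and α Φ₁))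
      (Formula.neg (Formula.and (Formula.neg α) Φ₀))),
      ((hα.and h1).neg.and (hα.neg.and h0).neg).neg, fun ν => ?_⟩
    by_cases h : Sat ν α
    · rw [h1' ν (by simp [h])]
      simp [Sat, h]
    · rw [h0' ν (by simp [h])]
      simp [Sat, h]

end

end Formula

/-- The linear terms in the variables `X` with bounded coefficients and constant. -/
noncomputable def boundedTerms (X : Finset Var) (A K : ℕ) : Finset LinTerm :=
  (X.finsupp (fun _ => Finset.Icc (-(A : ℤ)) A) ×ˢ Finset.Icc (-(K : ℤ)) K).image
    fun p => ⟨p.1, p.2⟩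

/-! ### Defining formulae over bounded atoms -/

section

variable {X : Finset Var} {A K : ℕ}

lemma mem_boundedTerms {t : LinTerm} : t ∈ boundedTerms X A K ↔
    t.coeff.support ⊆ X ∧ (∀ x ∈ X, |t.coeff x| ≤ A) ∧ |t.const| ≤ K := by
  simp only [boundedTerms, Finset.mem_image, Finset.mem_product, Finset.mem_finsupp_iff,
    Finset.mem_Icc, Prod.exists, abs_le]
  constructor
  · rintro ⟨f, c, ⟨⟨h1, h2⟩, h3⟩, rfl⟩
    exact ⟨h1, h2, h3⟩
  · rintro ⟨h1, h2, h3⟩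
    exact ⟨_, _, ⟨⟨h1, h2⟩, h3⟩, rfl⟩

lemma card_boundedTerms_le :
    (boundedTerms X A K).card ≤ (2 * A + 1) ^ X.card * (2 * K + 1) := by
  refine Finset.card_image_le.trans (le_of_eq ?_)
  rw [Finset.card_product, Finset.card_finsupp]
  simp only [Int.card_Icc, Finset.prod_const]
  congr 2 <;> omega

lemma norm_le_of_mem_boundedTerms {t : LinTerm} (h : t ∈ boundedTerms X A K) :
    t.norm ≤ max A K := by
  obtain ⟨h1, h2, h3⟩ := mem_boundedTerms.1 h
  refine max_le_max (Finset.sup_le fun x hx => ?_) (by rw [Int.abs_eq_natAbs] at h3; omega)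
  have := h2 x (h1 hx)
  rw [Int.abs_eq_natAbs] at this
  omega

lemma homogenize_mem_boundedTerms {t : LinTerm} (h : t ∈ boundedTerms X A K) :
    t.homogenize ∈ boundedTerms X A 0 := by
  rw [mem_boundedTerms] at h ⊢
  exact ⟨h.1, h.2.1, by simp [LinTerm.homogenize]⟩

/-- A property invariant under similarity is expressed by a quantifier-free formula with bounded
terms and a single modulus. -/
lemma exists_over_of_sim {Q : ℕ} (hQ : 0 < Q) (P : Assignment → Prop)
    (hP : ∀ ν ν', Sim X A K Q ν ν' → (P ν ↔ P ν')) :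
    ∃ Φ, Formula.Over (boundedTerms X A K) {1, Q} Φ ∧ ∀ ν, P ν ↔ Formula.Sat ν Φ := by
  classical
  let res : Var × ℕ → Formula := fun p =>
    Formula.modEq ⟨Finsupp.single p.1 1, -(p.2 : ℤ)⟩ ⟨Q, hQ⟩
  have hres : ∀ ν p, Formula.Sat ν (res p) ↔ (Q : ℤ) ∣ ν p.1 - p.2 := by
    intro ν p
    simp [res, Formula.Sat, LinTerm.eval, sub_eq_add_neg]
  refine Formula.exists_over (by simp) ((boundedTerms X A K).toList.map Formula.lt ++
    (X ×ˢ Finset.range Q).toList.map res) ?_ P ?_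
  · intro α hα
    simp only [List.mem_append, List.mem_map, Finset.mem_toList] at hα
    rcases hα with ⟨t, ht, rfl⟩ | ⟨p, -, rfl⟩
    · exact ⟨trivial, by simpa [Formula.lin] using ht, by simp [Formula.moduli]⟩
    · exact ⟨trivial, Finset.empty_subset _, subset_rfl⟩
  · intro ν ν' h
    refine hP ν ν' ⟨fun f hf c hc => ?_, fun x hx => ?_⟩
    · have hsupp : (Finsupp.indicator X fun x _ => f x).support ⊆ X :=
        Finsupp.support_indicator_subset _ _
      let t : LinTerm := ⟨Finsupp.indicator X fun x _ => f x, c⟩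
      have ht : t ∈ boundedTerms X A K := by
        refine mem_boundedTerms.2 ⟨hsupp, fun x hx => ?_, hc⟩
        simpa [t, hx] using hf x
      have hev : ∀ μ, t.eval μ = form X f μ + c := by
        intro μ
        rw [t.eval_eq_form_of_subset hsupp]
        congr 1
        exact Finset.sum_congr rfl fun x hx => by simp [t, hx]
      have := h (Formula.lt t) (List.mem_append_left _
        (List.mem_map_of_mem (Finset.mem_toList.2 ht)))
      simpa only [Formula.Sat, hev] using this
    · have hQ' : (0 : ℤ) < Q := by exact_mod_cast hQ
      have h0 := Int.emod_nonneg (ν x) hQ'.ne'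
      have h1 := Int.emod_lt_of_pos (ν x) hQ'
      obtain ⟨r, hr⟩ := Int.eq_ofNat_of_zero_le h0
      have hmem : (x, r) ∈ (X ×ˢ Finset.range Q).toList := by
        rw [Finset.mem_toList, Finset.mem_product, Finset.mem_range]
        exact ⟨hx, by omega⟩
      have := h (res (x, r)) (List.mem_append_right _ (List.mem_map_of_mem hmem))
      rw [hres, hres] at this
      have hν : (Q : ℤ) ∣ ν x - r := by
        rw [← hr]
        exact Int.dvd_self_sub_emod
      exact (Int.modEq_iff_dvd.2 hν).symm.trans (Int.modEq_iff_dvd.2 (this.1 hν))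

end

/-! ### Numerical estimates for the number of atoms -/

lemma two_mul_coeffBound_pow_le (l : ℕ) : (2 * coeffBound l + 1) ^ l ≤ 2 ^ 2 ^ (3 * l) := by
  have h1 : 2 * coeffBound l + 1 ≤ coeffBound l ^ 4 := by
    have := coeffBound_step l
    rw [← coeffBound_pow_four] at this
    have h2 := two_le_coeffBound l
    nlinarith
  calc _ ≤ (coeffBound l ^ 4) ^ l := Nat.pow_le_pow_left h1 l
    _ = 2 ^ (2 ^ l * (4 * l)) := by rw [coeffBound, ← pow_mul, ← pow_mul]
    _ ≤ 2 ^ 2 ^ (3 * l) := by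
      refine Nat.pow_le_pow_right two_pos ?_
      have h3 : 4 * l ≤ 2 ^ (2 * l) := by
        rw [pow_mul]
        cases l with
        | zero => simp
        | succ l =>
          have : l < (2 ^ 2) ^ l := Nat.lt_pow_self (by omega)
          rw [pow_succ]
          omega
      calc 2 ^ l * (4 * l) ≤ 2 ^ l * 2 ^ (2 * l) := by gcongr
        _ = _ := by rw [← pow_add]; congr 1; ring

lemma two_mul_constBound_le (l : ℕ) :
    2 ^ 2 ^ (3 * l) * (2 * constBound l + 1) ≤ 2 ^ 2 ^ 2 ^ (3 * l + 3) := by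
  have h1 : 2 ^ 2 ^ (3 * l) ≤ 2 ^ 2 ^ 2 ^ (3 * l + 1) :=
    Nat.pow_le_pow_right two_pos (Nat.pow_le_pow_right two_pos
      (Nat.lt_two_pow_self.le.trans (Nat.pow_le_pow_right two_pos (by omega))))
  have h2 : constBound l ≤ 2 ^ 2 ^ 2 ^ (3 * l + 1) := tower_mono (by omega)
  have h3 := sixteen_le_constBound l
  refine le_trans ?_ (tower_pow_four (3 * l + 1))
  generalize 2 ^ 2 ^ 2 ^ (3 * l + 1) = B at *
  calc _ ≤ B * (B * B) := by gcongr; nlinarith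
    _ ≤ B * B * (B * B) := by nlinarith [Nat.zero_le (B * (B * B))]
    _ = B ^ 4 := by ring

end PAC

theorem mainTheorem7 :
    ∃ C : ℕ, ∀ φ : PAC.Formula, ∃ Φ : PAC.Formula,
      Φ.QuantifierFree ∧ PAC.Formula.Equivalent φ Φ ∧
      Φ.lin.card ≤ 2 ^ (2 ^ (2 ^ (C * φ.length ^ 2))) ∧
      PAC.termsNorm Φ.lin ≤ 2 ^ (2 ^ (2 ^ (C * φ.length ^ 2))) ∧
      PAC.termsNorm Φ.hom ≤ 2 ^ (2 ^ (2 ^ (C * φ.length ^ 2))) ∧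
      PAC.natNorm Φ.moduli ≤ 2 ^ (2 ^ (2 ^ (C * φ.length ^ 2))) ∧
      Φ.hom.card ≤ 2 ^ (2 ^ (C * φ.length ^ 2)) ∧
      Φ.moduli.card ≤ φ.length := by
  -- The exponents obtained are at most `3 * l + 3`, linear in the length `l`; `4 * l ^ 2` exceeds
  -- this since `l ≥ 3`.
  refine ⟨4, fun φ => ?_⟩
  obtain ⟨Φ, ⟨hqf, hlin, hmod⟩, hΦ⟩ := PAC.exists_over_of_sim (Nat.factorial_pos _)
    (fun ν => PAC.Formula.Sat ν φ) φ.sat_iff_of_simLength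
  have hl := φ.three_le_length
  have hX := φ.card_vars_le
  generalize φ.length = l at *
  have hl2 : 3 * l + 3 ≤ 4 * l ^ 2 := by nlinarith
  have hK : PAC.constBound l ≤ 2 ^ 2 ^ 2 ^ (4 * l ^ 2) := PAC.tower_mono (by omega)
  have hA := PAC.coeffBound_le_constBound l
  have hpow : (2 * PAC.coeffBound l + 1) ^ φ.vars.card ≤ 2 ^ 2 ^ (3 * l) :=
    (Nat.pow_le_pow_right (by omega) hX).trans (PAC.two_mul_coeffBound_pow_le l)
  have hhom : Φ.hom ⊆ PAC.boundedTerms φ.vars (PAC.coeffBound l) 0 :=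
    Finset.image_subset_iff.2 fun t ht => PAC.homogenize_mem_boundedTerms (hlin ht)
  refine ⟨Φ, hqf, hΦ, ?_, ?_, ?_, ?_, ?_, ?_⟩
  · calc _ ≤ _ := Finset.card_le_card hlin
      _ ≤ _ := PAC.card_boundedTerms_le
      _ ≤ 2 ^ 2 ^ (3 * l) * (2 * PAC.constBound l + 1) := Nat.mul_le_mul_right _ hpow
      _ ≤ _ := PAC.two_mul_constBound_le l
      _ ≤ _ := PAC.tower_mono hl2
  · exact Finset.sup_le fun t ht =>
      (PAC.norm_le_of_mem_boundedTerms (hlin ht)).trans ((max_le hA le_rfl).trans hK)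
  · exact Finset.sup_le fun t ht =>
      (PAC.norm_le_of_mem_boundedTerms (hhom ht)).trans ((max_le hA (Nat.zero_le _)).trans hK)
  · refine Finset.sup_le fun q hq => le_trans ?_ hK
    rcases Finset.mem_insert.1 (hmod hq) with rfl | hq
    · exact (by decide : 1 ≤ 16).trans (PAC.sixteen_le_constBound l)
    · rw [Finset.mem_singleton.1 hq]
      exact PAC.modulus_le_constBound l
  · calc _ ≤ _ := Finset.card_le_card hhom
      _ ≤ _ := PAC.card_boundedTerms_le
      -- Homogeneous terms have the single constant 0, so the triply exponential factor for
      -- constants disappears.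
      _ ≤ 2 ^ 2 ^ (3 * l) := by simpa using hpow
      _ ≤ _ := Nat.pow_le_pow_right two_pos (Nat.pow_le_pow_right two_pos (by omega))
  · exact ((Finset.card_le_card hmod).trans Finset.card_le_two).trans (by omega)
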